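/- Let $\mathcal G$ be a connected undirected graph on $m$ nodes with Laplacian $\bar W$, let $W=\bar W\otimes I_n$, and let $\sqrt W$ be its positive semidefinite square root. For a matrix $A$ let $\sigma_{\max}(A)$ and $\sigma_{\min}(A)$ denote the largest and the smallest positive eigenvalue of $A^{T}A$ (no square root is taken), and let $\chi(W)=\lambda_{\max}(W)/\lambda_{\min}^{+}(W)$ be the ratio of the largest to the smallest positive eigenvalue of $W$. Let $f_1,\dots,f_m:\mathbb R^n\to\mathbb R$ and let $F(x)=\sum_{i=1}^m f_i(x_i)$ for $x=(x_1,\dots,x_m)\in\mathbb R^{mn}$. Let $\mu>0$ and suppose that $F$ is $\mu$-strongly convex in the Euclidean norm. Let $x^*$ be the solution of $$\min_{\sqrt W x=0}F(x), \tag{P}$$ and suppose that $F$ is $M$-Lipschitz on some neighbourhood of $x^*$. Suppose that $F$ is dual-friendly, i.e. the method may query the oracles $x_i^*(z^i)=\arg\max_{u\in\mathbb R^n}\{\langle z^i,u\rangle-f_i(u)\}$; write $x^*(z)=(x_1^*(z^1),\dots,x_m^*(z^m))$. Let $\varphi(y)=\max_x\{\langle \sqrt W y,x\rangle-F(x)\}$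 be the dual function. Then $\varphi$ has a minimizer of smallest norm, and its norm $R$ satisfies $R^2\le M^2/\sigma_{\min}(\sqrt W)$. Suppose moreover that $R>0$. Let $\varepsilon>0$, $\nu=\varepsilon/R^2$, $L_\varphi=\sigma_{\max}(\sqrt W)/\mu$, $L=L_\varphi+\nu$, and run the distributed iteration $z_0=\tilde z_0=0$, $$z^i_{k+1}=\tilde z^i_k-\tfrac1L\Big(\sum_{j=1}^m \bar W_{ij}\,x_j^*(\tilde z^j_k)+\nu\tilde z^i_k\Big),\qquad \tilde z^i_{k+1}=z^i_{k+1}+\frac{\sqrt L-\sqrt\nu}{\sqrt L+\sqrt\nu}\,(z^i_{k+1}-z^i_k),$$ in which each agent makes one oracle call per iteration. This is the fast gradient method, with smoothness constant $L$, strong convexity constant $\nu$ and starting point $y_0=\tilde y_0=0$, applied to the regularized dual function $\varphi(y)+\frac{\varepsilon}{2R^2}\|y\|_2^2$, in the variables $z_k=\sqrt W y_k$. There is an absolute constant $C$ such that, with $K=\dfrac{M^2\chi(W)}{\mu\varepsilon}$, for every integer $N\ge C\sqrt K\,\log(2+K)$, that is, after $N=\tilde O\Big(\sqrt{\tfrac{M^2}{\mu\varepsilon}\chi(W)}\Big)$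 iterations (oracle calls), the point $x^*(z_N)$ is an $(\varepsilon,\varepsilon/R)$-optimal solution of (P): $$F(x^*(z_N))-F(x^*)\le\varepsilon\qquad\text{and}\qquad \|\sqrt W\,x^*(z_N)\|_2\le\varepsilon/R .$$ -/

import Mathlib

open scoped MatrixOrder Kronecker Topology

noncomputable section

/-! ### Singular values and the condition number -/

/-- The largest eigenvalue of a real square matrix. -/
def lamMax {k : Type} [Fintype k] (B : Matrix k k ℝ) : ℝ :=
  sSup {l : ℝ | ∃ x : k → ℝ, x ≠ 0 ∧ B.mulVec x = l • x}

/-- The smallest positive eigenvalue of a real square matrix. -/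
def lamMinPos {k : Type} [Fintype k] (B : Matrix k k ℝ) : ℝ :=
  sInf {l : ℝ | 0 < l ∧ ∃ x : k → ℝ, x ≠ 0 ∧ B.mulVec x = l • x}

/-- `σ_max(A) = λ_max(AᵀA)`. With this convention there is no square root. -/
def sigmaMax {k : Type} [Fintype k] (A : Matrix k k ℝ) : ℝ := lamMax (A.transpose * A)

/-- `σ_min(A)`: the smallest positive eigenvalue of `AᵀA`, again without a square root. -/
def sigmaMin {k : Type} [Fintype k] (A : Matrix k k ℝ) : ℝ := lamMinPos (A.transpose * A)

/-- The condition number `χ(B)` of a positive semidefinite matrix `B`, so that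
`χ(AᵀA) = σ_max(A) / σ_min(A)`. -/
def chi {k : Type} [Fintype k] (B : Matrix k k ℝ) : ℝ := lamMax B / lamMinPos B

/-! ### The network -/

/-- The communication matrix `W = W̄ ⊗ I_n`, where `W̄` is the graph Laplacian. -/
def commMatrix {m : ℕ} (n : ℕ) (G : SimpleGraph (Fin m)) [DecidableRel G.Adj] :
    Matrix (Fin m × Fin n) (Fin m × Fin n) ℝ :=
  G.lapMatrix ℝ ⊗ₖ (1 : Matrix (Fin n) (Fin n) ℝ)

/-- The positive semidefinite square root `√W` of the communication matrix. -/
def sqrtComm {m : ℕ} (n : ℕ) (G : SimpleGraph (Fin m)) [DecidableRel G.Adj] :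
    Matrix (Fin m × Fin n) (Fin m × Fin n) ℝ :=
  CFC.sqrt (commMatrix n G)

/-- The stacked vector `[x_1; …; x_m] ∈ ℝ^{mn}` of the agents' vectors `x_i ∈ ℝ^n`. -/
def stack {m n : ℕ} (u : Fin m → EuclideanSpace ℝ (Fin n)) :
    EuclideanSpace ℝ (Fin m × Fin n) :=
  WithLp.toLp 2 fun p => u p.1 p.2

/-- The `i`-th block `x_i ∈ ℝ^n` of a stacked vector `x ∈ ℝ^{mn}`. -/
def block {m n : ℕ} (x : EuclideanSpace ℝ (Fin m × Fin n)) (i : Fin m) :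
    EuclideanSpace ℝ (Fin n) :=
  WithLp.toLp 2 fun a => x (i, a)

/-- The objective `F(x) = ∑ i, f_i(x_i)` on `ℝ^{mn}`. -/
def totalCost {m n : ℕ} (f : Fin m → EuclideanSpace ℝ (Fin n) → ℝ)
    (x : EuclideanSpace ℝ (Fin m × Fin n)) : ℝ :=
  ∑ i, f i (block x i)

/-! ### The linearly constrained problem and its dual -/

/-- `x` solves `min F(x)` subject to `A x = 0`. -/
def IsPrimalSolution {k : Type} [Fintype k] [DecidableEq k] (F : EuclideanSpace ℝ k → ℝ)
    (A : Matrix k k ℝ) (x : EuclideanSpace ℝ k) : Prop :=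
  A.toEuclideanLin x = 0 ∧ ∀ x', A.toEuclideanLin x' = 0 → F x ≤ F x'

/-- `x` is an `(ε, ε')`-optimal solution of `min F` subject to `A x = 0`, where `xstar` is an
exact solution. -/
def IsApproxSolution {k : Type} [Fintype k] [DecidableEq k] (F : EuclideanSpace ℝ k → ℝ)
    (A : Matrix k k ℝ) (xstar : EuclideanSpace ℝ k) (ε ε' : ℝ) (x : EuclideanSpace ℝ k) : Prop :=
  F x - F xstar ≤ ε ∧ ‖A.toEuclideanLin x‖ ≤ ε'

/-- The dual function `φ(y) = max_x (⟨Aᵀ y, x⟩ - F(x))`. -/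
def dualFun {k : Type} [Fintype k] [DecidableEq k] (F : EuclideanSpace ℝ k → ℝ)
    (A : Matrix k k ℝ) (y : EuclideanSpace ℝ k) : ℝ :=
  ⨆ x : EuclideanSpace ℝ k, (inner ℝ (A.transpose.toEuclideanLin y) x - F x)

/-- `y` is a minimizer of the dual function of smallest norm. -/
def IsMinNormDualSolution {k : Type} [Fintype k] [DecidableEq k] (F : EuclideanSpace ℝ k → ℝ)
    (A : Matrix k k ℝ) (y : EuclideanSpace ℝ k) : Prop :=
  (∀ y', dualFun F A y ≤ dualFun F A y') ∧
    ∀ y', (∀ y'', dualFun F A y' ≤ dualFun F A y'') → ‖y‖ ≤ ‖y'‖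

/-- The regularized function `ψ(y) + (ν/2) ‖y‖²`. -/
def regularized {k : Type} [Fintype k] (ψ : EuclideanSpace ℝ k → ℝ) (ν : ℝ)
    (y : EuclideanSpace ℝ k) : ℝ :=
  ψ y + ν / 2 * ‖y‖ ^ 2

/-- The dual oracle of one agent: `xs z` maximizes `⟨z, x⟩ - g(x)` over `x ∈ ℝ^n`. -/
def IsDualOracle {n : ℕ} (g : EuclideanSpace ℝ (Fin n) → ℝ)
    (xs : EuclideanSpace ℝ (Fin n) → EuclideanSpace ℝ (Fin n)) : Prop :=
  ∀ z x, inner ℝ z x - g x ≤ inner ℝ z (xs z) - g (xs z)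

/-! ### The fast gradient method -/

/-- Nesterov's fast gradient method, started at `0`, for an `L`-smooth, `ν`-strongly convex
function `ψ`. The value at `k` is the pair `(y_k, ỹ_k)` of the main and the extrapolated point. -/
def fgm {k : Type} [Fintype k] (L ν : ℝ) (ψ : EuclideanSpace ℝ k → ℝ) :
    ℕ → EuclideanSpace ℝ k × EuclideanSpace ℝ k
  | 0 => (0, 0)
  | t + 1 =>
    let p := fgm L ν ψ t
    let y := p.2 - (1 / L) • gradient ψ p.2
    (y, y + ((√L - √ν) / (√L + √ν)) • (y - p.1))

/-- The distributed fast gradient method on the regularized dual problem, in the variables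
`z = √W y`. Here `Lφ` is the smoothness constant of the dual function and `ν` is the regularization
parameter, so the regularized dual function is `ν`-strongly convex and `(Lφ + ν)`-smooth.
The value at `t` is the pair `(z_t, z̃_t)`, agent by agent. In one iteration every agent `j` calls
its oracle `xs j` once, at `z̃_t^j`, and agent `i` uses the answers of its neighbours only,
because `W̄_ij = 0` if `i ≠ j` are not adjacent. -/
def distributedFGM {m n : ℕ} (G : SimpleGraph (Fin m)) [DecidableRel G.Adj]
    (xs : Fin m → EuclideanSpace ℝ (Fin n) → EuclideanSpace ℝ (Fin n)) (Lφ ν : ℝ) :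
    ℕ → (Fin m → EuclideanSpace ℝ (Fin n)) × (Fin m → EuclideanSpace ℝ (Fin n))
  | 0 => (0, 0)
  | t + 1 =>
    let p := distributedFGM G xs Lφ ν t
    let z : Fin m → EuclideanSpace ℝ (Fin n) := fun i =>
      p.2 i - (1 / (Lφ + ν)) • ((∑ j, G.lapMatrix ℝ i j • xs j (p.2 j)) + ν • p.2 i)
    (z, fun i => z i + ((√(Lφ + ν) - √ν) / (√(Lφ + ν) + √ν)) • (z i - p.1 i))

end

/-! ### Extreme eigenvalues of positive semidefinite matrices -/

section Spectral

variable {k : Type} [Fintype k]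

/-! Write `A` for `√W`, `L` for `L_φ`, `κ = L / ν`. Strong convexity of `F` makes `φ` convex and
`L`-smooth with gradient `A x*(A y)`, so the gradient norm is exactly the constraint violation.

A subgradient of `F` at `x*` orthogonal to `ker A` has the form `A y` with `y ⟂ ker A`. Such a `y`
is a dual solution, and `‖A y‖ ≤ M` bounds its norm; hence `κ ≤ K`.

Let `u` minimize the regularized dual, `a = ‖u‖`, `b = ‖y* - u‖`, and let `d` be the distance from
the iterate `y` to `u`. Strong convexity gives `a² + b² ≤ R²`, and smoothness with `∇φ(u) = -ν u`
gives `a ≤ κ b`. So `a` stays below `R` by a margin polynomial in `κ`, and linear convergence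
(`norm_fgm_sub_sq_le`) pushes `d` below it at logarithmic cost (`mul_add_le_of_iterations`). Then
`‖∇φ(y)‖ ≤ ν (κ d + a) ≤ ν R = ε / R` and `‖y‖ ≤ R`. Weak duality bounds the objective gap by `⟨y,
∇φ(y)⟩ ≤ ε`, with no loss of constants (`isApproxSolution_fgm`). -/

lemma finite_setOf_eigenvalue [DecidableEq k] (B : Matrix k k ℝ) :
    {l : ℝ | ∃ x : k → ℝ, x ≠ 0 ∧ B.mulVec x = l • x}.Finite := by
  refine (Matrix.finite_spectrum (R := ℝ) B).subset ?_
  rintro l ⟨x, hx, h⟩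
  rw [← Matrix.spectrum_toLin']
  refine (Module.End.hasEigenvalue_of_hasEigenvector (x := x) ⟨?_, hx⟩).mem_spectrum
  rw [Module.End.mem_eigenspace_iff]
  simpa using h

lemma Matrix.PosSemidef.eigenvalue_nonneg {B : Matrix k k ℝ} (hB : B.PosSemidef) {l : ℝ}
    {x : k → ℝ} (hx : x ≠ 0) (h : B.mulVec x = l • x) : 0 ≤ l := by
  have h0 := hB.dotProduct_mulVec_nonneg x
  rw [h, dotProduct_smul, smul_eq_mul] at h0
  have h1 : 0 < dotProduct (star x) x := Matrix.dotProduct_star_self_pos_iff.mpr hx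
  exact nonneg_of_mul_nonneg_left h0 h1

lemma Matrix.PosSemidef.lamMax_nonneg {B : Matrix k k ℝ} (hB : B.PosSemidef) : 0 ≤ lamMax B :=
  Real.sSup_nonneg fun _ ⟨_, hx, h⟩ => hB.eigenvalue_nonneg hx h

lemma lamMinPos_nonneg (B : Matrix k k ℝ) : 0 ≤ lamMinPos B :=
  Real.sInf_nonneg fun _ h => h.1.le

variable [DecidableEq k]

/-- An infimum over a finite nonempty set is attained, hence is itself a positive eigenvalue. -/
lemma lamMinPos_pos {B : Matrix k k ℝ} {l : ℝ} (hl : 0 < l) {x : k → ℝ} (hx : x ≠ 0)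
    (h : B.mulVec x = l • x) : 0 < lamMinPos B := by
  have hfin : {l : ℝ | 0 < l ∧ ∃ x : k → ℝ, x ≠ 0 ∧ B.mulVec x = l • x}.Finite :=
    (finite_setOf_eigenvalue B).subset fun _ h => h.2
  have hne : {l : ℝ | 0 < l ∧ ∃ x : k → ℝ, x ≠ 0 ∧ B.mulVec x = l • x}.Nonempty :=
    ⟨l, hl, x, hx, h⟩
  exact (hne.csInf_mem hfin).1

lemma Matrix.IsHermitian.toEuclideanLin_eigenvectorBasis {B : Matrix k k ℝ} (hB : B.IsHermitian)
    (i : k) : B.toEuclideanLin (hB.eigenvectorBasis i) =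
      hB.eigenvalues i • hB.eigenvectorBasis i := by
  ext j
  exact congrFun (hB.mulVec_eigenvectorBasis i) j

lemma Matrix.IsHermitian.eigenvectorBasis_ne_zero {B : Matrix k k ℝ} (hB : B.IsHermitian)
    (i : k) : (hB.eigenvectorBasis i : k → ℝ) ≠ 0 := by
  intro h
  have h1 := hB.eigenvectorBasis.orthonormal.ne_zero i
  exact h1 (by ext j; exact congrFun h j)

lemma Matrix.IsHermitian.inner_toEuclideanLin_self {B : Matrix k k ℝ} (hB : B.IsHermitian)
    (y : EuclideanSpace ℝ k) : inner ℝ y (B.toEuclideanLin y) =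
      ∑ i, hB.eigenvalues i * inner ℝ (hB.eigenvectorBasis i) y ^ 2 := by
  rw [← hB.eigenvectorBasis.sum_inner_mul_inner]
  refine Finset.sum_congr rfl fun i _ => ?_
  rw [← Matrix.isSymmetric_toEuclideanLin_iff.mpr hB, hB.toEuclideanLin_eigenvectorBasis,
    real_inner_smul_left, real_inner_comm]
  ring

lemma Matrix.IsHermitian.inner_toEuclideanLin_self_le_lamMax {B : Matrix k k ℝ}
    (hB : B.IsHermitian) (y : EuclideanSpace ℝ k) :
    inner ℝ y (B.toEuclideanLin y) ≤ lamMax B * ‖y‖ ^ 2 := by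
  rw [hB.inner_toEuclideanLin_self, ← hB.eigenvectorBasis.sum_sq_norm_inner_right, Finset.mul_sum]
  refine Finset.sum_le_sum fun i _ => ?_
  rw [Real.norm_eq_abs, sq_abs]
  gcongr
  exact le_csSup (finite_setOf_eigenvalue B).bddAbove
    ⟨_, hB.eigenvectorBasis_ne_zero i, hB.mulVec_eigenvectorBasis i⟩

/-- On the orthogonal complement of its kernel, a positive semidefinite matrix is bounded below by
its smallest positive eigenvalue. -/
lemma Matrix.PosSemidef.lamMinPos_mul_le_inner {B : Matrix k k ℝ} (hB : B.PosSemidef)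
    {y : EuclideanSpace ℝ k} (hy : ∀ x, B.toEuclideanLin x = 0 → inner ℝ x y = 0) :
    lamMinPos B * ‖y‖ ^ 2 ≤ inner ℝ y (B.toEuclideanLin y) := by
  have hH := hB.isHermitian
  rw [hH.inner_toEuclideanLin_self, ← hH.eigenvectorBasis.sum_sq_norm_inner_right, Finset.mul_sum]
  refine Finset.sum_le_sum fun i _ => ?_
  rw [Real.norm_eq_abs, sq_abs]
  rcases (hB.eigenvalues_nonneg i).eq_or_lt with h0 | h0
  · rw [hy _ (by rw [hH.toEuclideanLin_eigenvectorBasis, ← h0, zero_smul])]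
    simp
  · gcongr
    exact csInf_le ⟨0, fun _ h => h.1.le⟩
      ⟨h0, _, hH.eigenvectorBasis_ne_zero i, hH.mulVec_eigenvectorBasis i⟩

/-- A positive semidefinite matrix without positive eigenvalues is zero, so a nonzero vector
orthogonal to the kernel forces `lamMinPos` to be positive. -/
lemma Matrix.PosSemidef.lamMinPos_pos_of_orthogonal_ker {B : Matrix k k ℝ} (hB : B.PosSemidef)
    {y : EuclideanSpace ℝ k} (hy : ∀ x, B.toEuclideanLin x = 0 → inner ℝ x y = 0) (hy0 : y ≠ 0) :
    0 < lamMinPos B := by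
  have hH := hB.isHermitian
  by_contra hn
  have h0 (i : k) : hH.eigenvalues i = 0 := by
    by_contra hi
    exact hn (lamMinPos_pos ((hB.eigenvalues_nonneg i).lt_of_ne' hi)
      (hH.eigenvectorBasis_ne_zero i) (hH.mulVec_eigenvectorBasis i))
  refine hy0 (norm_eq_zero.mp (pow_eq_zero_iff two_ne_zero |>.mp ?_))
  rw [← hH.eigenvectorBasis.sum_sq_norm_inner_right]
  refine Finset.sum_eq_zero fun i _ => ?_
  rw [hy _ (by rw [hH.toEuclideanLin_eigenvectorBasis, h0, zero_smul])]
  simp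

end Spectral

/-! ### Strong convexity and subgradients -/

section Convex

variable {E : Type*} [NormedAddCommGroup E] [InnerProductSpace ℝ E]

/-- Quadratic growth of a strongly convex function above a supporting affine function. -/
lemma StrongConvexOn.add_inner_add_le {F : E → ℝ} {μ : ℝ} (hF : StrongConvexOn Set.univ μ F)
    {z a : E} (ha : ∀ x, inner ℝ z x - F x ≤ inner ℝ z a - F a) (x : E) :
    F a + inner ℝ z (x - a) + μ / 2 * ‖x - a‖ ^ 2 ≤ F x := by
  -- Strong convexity on the segment from `a` to `x`, combined with maximality of `a` against the
  -- intermediate point and divided by `t`. The factor `1 - t` disappears as `t → 0+`.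
  have key (t : ℝ) (ht : 0 < t) (ht1 : t < 1) :
      (1 - t) * (μ / 2 * ‖x - a‖ ^ 2) ≤ F x - F a - inner ℝ z (x - a) := by
    have h1 := hF.2 (Set.mem_univ x) (Set.mem_univ a) ht.le (sub_nonneg.mpr ht1.le) (by ring)
    have h2 := ha (t • x + (1 - t) • a)
    simp only [smul_eq_mul, inner_add_right, real_inner_smul_right] at h1 h2
    rw [inner_sub_right]
    refine le_of_mul_le_mul_left ?_ ht
    linarith
  have hlim : Filter.Tendsto (fun t : ℝ => (1 - t) * (μ / 2 * ‖x - a‖ ^ 2)) (𝓝[>] 0)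
      (𝓝 ((1 - 0) * (μ / 2 * ‖x - a‖ ^ 2))) :=
    (Continuous.tendsto (by fun_prop) 0).mono_left nhdsWithin_le_nhds
  have := le_of_tendsto hlim (Filter.mem_of_superset
    (Ioo_mem_nhdsGT one_pos) fun t ht => key t ht.1 ht.2)
  linarith

/-- A convex function that is minimal at `a` along a subspace has a subgradient at `a` that is
orthogonal to the subspace. -/
lemma ConvexOn.exists_subgradient_orthogonal [FiniteDimensional ℝ E] {F : E → ℝ}
    (hF : ConvexOn ℝ Set.univ F) (S : Submodule ℝ E) {a : E} (haS : a ∈ S)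
    (ha : ∀ x ∈ S, F a ≤ F x) :
    ∃ g : E, (∀ x, F a + inner ℝ g (x - a) ≤ F x) ∧ ∀ x ∈ S, inner ℝ g x = 0 := by
  have hc : Continuous F := continuousOn_univ.mp (hF.continuousOn isOpen_univ)
  have hs₁ : Convex ℝ {p : E × ℝ | F p.1 < p.2} := by
    simpa using hF.convex_strict_epigraph
  have hs₂ : IsOpen {p : E × ℝ | F p.1 < p.2} :=
    isOpen_lt (hc.comp continuous_fst) continuous_snd
  have ht : Convex ℝ ((S : Set E) ×ˢ ({F a} : Set ℝ)) := S.convex.prod (convex_singleton _)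
  -- Separate the open strict epigraph from `S × {F a}`; the slope of the separating hyperplane is
  -- the subgradient.
  obtain ⟨f, u, hlt, hle⟩ := geometric_hahn_banach_open hs₁ hs₂ ht (by
    rw [Set.disjoint_left]
    rintro ⟨x, r⟩ hx ⟨hxS, hr⟩
    simp only [Set.mem_ofPred_eq, Set.mem_singleton_iff] at hx hr
    exact absurd (ha x hxS) (by rw [← hr]; exact not_le.mpr hx))
  set h : E →L[ℝ] ℝ := f.comp (ContinuousLinearMap.inl ℝ E ℝ)
  set c : ℝ := f (0, 1)
  have hf (x : E) (r : ℝ) : f (x, r) = h x + c * r := by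
    have : ((x, r) : E × ℝ) = (x, 0) + r • (0, 1) := by simp
    rw [this, map_add, map_smul, smul_eq_mul, mul_comm]
    rfl
  have hSx (x : E) (hx : x ∈ S) : h x = 0 := by
    have hb (t : ℝ) : u ≤ t * h x + c * F a := by
      have := hle (t • x, F a) ⟨S.smul_mem t hx, rfl⟩
      rwa [hf, map_smul, smul_eq_mul] at this
    by_contra hne
    -- A linear form bounded below on a subspace vanishes there: this multiple of `x` would give `u
    -- ≤ u - 1`.
    have := hb ((u - c * F a - 1) / h x)
    rw [div_mul_cancel₀ _ hne] at this
    linarith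
  have hu : u ≤ c * F a := by
    have := hle (a, F a) ⟨haS, rfl⟩
    rwa [hf, hSx a haS, zero_add] at this
  have hc0 : c < 0 := by
    have := hlt (a, F a + 1) (by simp)
    rw [hf, hSx a haS] at this
    linarith
  refine ⟨(-c)⁻¹ • (InnerProductSpace.toDual ℝ E).symm h, fun x => ?_, fun x hx => ?_⟩
  · have hx : h x + c * F x ≤ c * F a := by
      -- The strict epigraph omits the graph, so the graph point is approached from height `δ /
      -- (-c)` above it.
      refine le_of_forall_pos_le_add fun δ hδ => ?_
      have := hlt (x, F x + δ / (-c)) (by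
        simp only [Set.mem_ofPred_eq]
        have : 0 < δ / (-c) := div_pos hδ (neg_pos.mpr hc0)
        linarith)
      rw [hf, mul_add, show c * (δ / (-c)) = -δ by
        rw [div_neg, mul_neg, mul_div_cancel₀ _ hc0.ne]] at this
      linarith
    rw [real_inner_smul_left, InnerProductSpace.toDual_symm_apply, map_sub, hSx a haS, sub_zero,
      inv_mul_eq_div]
    have h1 : h x / (-c) ≤ F x - F a := by
      rw [div_le_iff₀ (neg_pos.mpr hc0)]
      linarith
    linarith
  · rw [real_inner_smul_left, InnerProductSpace.toDual_symm_apply, hSx x hx, mul_zero]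

/-- A subgradient at a point near which the function is Lipschitz is bounded by the Lipschitz
constant. -/
lemma norm_subgradient_le {F : E → ℝ} {a g : E} {U : Set E} (hU : U ∈ 𝓝 a) {M : NNReal}
    (hM : LipschitzOnWith M F U) (hg : ∀ x, F a + inner ℝ g (x - a) ≤ F x) : ‖g‖ ≤ M := by
  -- Test along `g` itself: for small `t > 0`, `t‖g‖² ≤ F (a + t g) - F a ≤ M t ‖g‖`.
  have hcont : Filter.Tendsto (fun t : ℝ => a + t • g) (𝓝[>] 0) (𝓝 a) := by
    have : Filter.Tendsto (fun t : ℝ => a + t • g) (𝓝 0) (𝓝 (a + (0 : ℝ) • g)) :=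
      Continuous.tendsto (by fun_prop) 0
    simpa using this.mono_left nhdsWithin_le_nhds
  obtain ⟨t, htU, ht : 0 < t⟩ := ((hcont.eventually_mem hU).and self_mem_nhdsWithin).exists
  have h1 := hM.dist_le_mul _ htU _ (mem_of_mem_nhds hU)
  have h2 := hg (a + t • g)
  rw [Real.dist_eq, dist_eq_norm, add_sub_cancel_left, norm_smul, Real.norm_of_nonneg ht.le] at h1
  rw [add_sub_cancel_left, real_inner_smul_right, real_inner_self_eq_norm_sq] at h2
  have h3 : t * ‖g‖ * ‖g‖ ≤ t * ‖g‖ * M := by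
    have := le_abs_self (F (a + t • g) - F a)
    linarith
  rcases (norm_nonneg g).eq_or_lt with h0 | h0
  · rw [← h0]
    exact M.2
  · exact le_of_mul_le_mul_left h3 (mul_pos ht h0)

/-- The first-order remainder lies between `0` and a multiple of `‖y - x‖²`, hence is `o(‖y - x‖)`.
-/
lemma hasGradientAt_of_quadratic_bounds [CompleteSpace E] {ψ : E → ℝ} {x g : E} {L : ℝ}
    (hlow : ∀ y, ψ x + inner ℝ g (y - x) ≤ ψ y)
    (hup : ∀ y, ψ y ≤ ψ x + inner ℝ g (y - x) + L / 2 * ‖y - x‖ ^ 2) :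
    HasGradientAt ψ g x := by
  rw [hasGradientAt_iff_isLittleO]
  have h1 : (fun y => ψ y - ψ x - inner ℝ g (y - x)) =O[𝓝 x] fun y => ‖y - x‖ ^ 2 := by
    refine Asymptotics.IsBigO.of_bound (L / 2) (Filter.Eventually.of_forall fun y => ?_)
    rw [Real.norm_of_nonneg (by linarith [hlow y]), Real.norm_of_nonneg (by positivity)]
    linarith [hup y]
  refine h1.trans_isLittleO ?_
  have h2 : (fun y => y - x) =o[𝓝 x] fun _ => (1 : ℝ) := by
    rw [Asymptotics.isLittleO_one_iff]
    exact Continuous.tendsto' (by fun_prop) _ _ (sub_self x)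
  simpa [pow_two] using (h2.norm_left.mul_isBigO (Asymptotics.isBigO_refl (fun y => ‖y - x‖) (𝓝 x)))

end Convex

/-! ### The dual function -/

section Dual

variable {E : Type*} [NormedAddCommGroup E] [InnerProductSpace ℝ E] {F : E → ℝ} {X : E → E}
  {μ s : ℝ} {T : E →ₗ[ℝ] E}

/-- The maximizer of `⟨z, ·⟩ - F` depends on `z` in a `1/μ`-Lipschitz way if `F` is `μ`-strongly
convex. -/
lemma StrongConvexOn.mul_norm_oracle_sub_le (hF : StrongConvexOn Set.univ μ F)
    (hX : ∀ z x, inner ℝ z x - F x ≤ inner ℝ z (X z) - F (X z)) (z w : E) :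
    μ * ‖X z - X w‖ ≤ ‖z - w‖ := by
  -- Adding the two growth inequalities gives `μ ‖X z - X w‖² ≤ ⟨z - w, X z - X w⟩`; Cauchy–Schwarz
  -- finishes.
  have h1 := hF.add_inner_add_le (hX z) (X w)
  have h2 := hF.add_inner_add_le (hX w) (X z)
  have h3 : inner ℝ (z - w) (X z - X w) = -inner ℝ z (X w - X z) - inner ℝ w (X z - X w) := by
    rw [← neg_sub (X z) (X w), inner_neg_right, inner_sub_left]
    ring
  have h4 := real_inner_le_norm (z - w) (X z - X w)
  rw [norm_sub_rev (X w)] at h1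
  rcases (norm_nonneg (X z - X w)).eq_or_lt with h0 | h0
  · rw [← h0, mul_zero]
    exact norm_nonneg _
  · refine le_of_mul_le_mul_right ?_ h0
    nlinarith

/-- The value of the dual function `y ↦ max_x (⟨T y, x⟩ - F x)`, computed by the oracle `X`. -/
noncomputable def dualValue (F : E → ℝ) (X : E → E) (T : E →ₗ[ℝ] E) (y : E) : ℝ :=
  inner ℝ (T y) (X (T y)) - F (X (T y))

/-- The maximizer for `y` is a competitor in the supremum for `w`. -/
lemma dualValue_add_inner_le (hT : T.IsSymmetric)
    (hX : ∀ z x, inner ℝ z x - F x ≤ inner ℝ z (X z) - F (X z)) (y w : E) :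
    dualValue F X T y + inner ℝ (T (X (T y))) (w - y) ≤ dualValue F X T w := by
  have h := hX (T w) (X (T y))
  rw [hT, map_sub, inner_sub_right, real_inner_comm, real_inner_comm (T y)]
  unfold dualValue
  linarith

/-- Quadratic growth of `F` at `X (T y)` leaves a term `⟨p, q⟩ - μ/2 ‖q‖²` with `p = T w - T y`,
which is at most `‖p‖² / (2μ)`. -/
lemma dualValue_le_add_inner_add (hμ : 0 < μ) (hF : StrongConvexOn Set.univ μ F)
    (hT : T.IsSymmetric) (hs : ∀ d, ‖T d‖ ^ 2 ≤ s * ‖d‖ ^ 2)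
    (hX : ∀ z x, inner ℝ z x - F x ≤ inner ℝ z (X z) - F (X z)) (y w : E) :
    dualValue F X T w ≤
      dualValue F X T y + inner ℝ (T (X (T y))) (w - y) + s / μ / 2 * ‖w - y‖ ^ 2 := by
  have h := hF.add_inner_add_le (hX (T y)) (X (T w))
  have h1 : inner ℝ (T w - T y) (X (T w) - X (T y)) - μ / 2 * ‖X (T w) - X (T y)‖ ^ 2 ≤
      s / μ / 2 * ‖w - y‖ ^ 2 := by
    have h2 := real_inner_le_norm (T w - T y) (X (T w) - X (T y))
    have h3 := hs (w - y)
    rw [map_sub] at h3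
    have h4 : s / μ / 2 * ‖w - y‖ ^ 2 = s * ‖w - y‖ ^ 2 / (2 * μ) := by
      field_simp
    rw [h4, le_div_iff₀ (by positivity)]
    nlinarith [sq_nonneg (‖T w - T y‖ - μ * ‖X (T w) - X (T y)‖)]
  rw [hT, map_sub]
  simp only [inner_sub_left, inner_sub_right] at h h1 ⊢
  rw [real_inner_comm (T w) (X (T y)), real_inner_comm (T y) (X (T y))]
  unfold dualValue
  linarith

/-- The gradient `T ∘ X ∘ T` of the dual function is Lipschitz. -/
lemma StrongConvexOn.norm_map_oracle_sub_le (hμ : 0 < μ) (hF : StrongConvexOn Set.univ μ F)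
    (hs0 : 0 ≤ s) (hs : ∀ d, ‖T d‖ ^ 2 ≤ s * ‖d‖ ^ 2)
    (hX : ∀ z x, inner ℝ z x - F x ≤ inner ℝ z (X z) - F (X z)) (y w : E) :
    ‖T (X (T y)) - T (X (T w))‖ ≤ s / μ * ‖y - w‖ := by
  have hs' (d : E) : ‖T d‖ ≤ √s * ‖d‖ := by
    refine le_of_sq_le_sq ?_ (by positivity)
    rw [mul_pow, Real.sq_sqrt hs0]
    exact hs d
  have h1 := hF.mul_norm_oracle_sub_le hX (T y) (T w)
  rw [← map_sub] at h1 ⊢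
  calc ‖T (X (T y) - X (T w))‖ ≤ √s * ‖X (T y) - X (T w)‖ := hs' _
    _ ≤ √s * (√s * ‖y - w‖ / μ) := by
        gcongr
        rw [le_div_iff₀ hμ, mul_comm]
        exact h1.trans (hs' _)
    _ = s / μ * ‖y - w‖ := by
        rw [← mul_div_assoc, ← mul_assoc, Real.mul_self_sqrt hs0]
        ring

lemma add_inner_add_quadratic (ν : ℝ) (y w : E) :
    ν / 2 * ‖w‖ ^ 2 = ν / 2 * ‖y‖ ^ 2 + inner ℝ (ν • y) (w - y) + ν / 2 * ‖w - y‖ ^ 2 := by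
  rw [norm_sub_sq_real, real_inner_smul_left, inner_sub_right, real_inner_self_eq_norm_sq,
    real_inner_comm w y]
  ring

end Dual

/-! ### Convergence of the fast gradient method -/

section FastGradient

variable {k : Type} [Fintype k]

/-- Linear convergence of the fast gradient method on smooth strongly convex functions. -/
lemma fgm_sub_add_le {ψ : EuclideanSpace ℝ k → ℝ} {L ν : ℝ} (hν : 0 < ν) (hL : ν ≤ L)
    (hlow : ∀ x y, ψ x + inner ℝ (gradient ψ x) (y - x) + ν / 2 * ‖y - x‖ ^ 2 ≤ ψ y)
    (hup : ∀ x y, ψ y ≤ ψ x + inner ℝ (gradient ψ x) (y - x) + L / 2 * ‖y - x‖ ^ 2)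
    (u : EuclideanSpace ℝ k) (t : ℕ) :
    ψ (fgm L ν ψ t).1 - ψ u ≤ (1 - √(ν / L)) ^ t * (ψ 0 - ψ u + ν / 2 * ‖u‖ ^ 2) := by
  have hL0 : 0 < L := hν.trans_le hL
  set θ : ℝ := √(ν / L) with hθ
  have hθ0 : 0 < θ := Real.sqrt_pos.mpr (div_pos hν hL0)
  have hθ1 : θ ≤ 1 := by
    exact (Real.sqrt_le_sqrt ((div_le_one hL0).mpr hL)).trans_eq Real.sqrt_one
  have hθν : θ ^ 2 * L = ν := by
    rw [hθ, Real.sq_sqrt (div_pos hν hL0).le, div_mul_cancel₀ _ hL0.ne']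
  have hβ : (√L - √ν) / (√L + √ν) = (1 - θ) / (1 + θ) := by
    have h1 : 0 < √L := Real.sqrt_pos.mpr hL0
    have h2 : √ν = θ * √L := by
      rw [hθ, Real.sqrt_div hν.le, div_mul_cancel₀ _ h1.ne']
    rw [h2, div_eq_div_iff (by positivity) (by positivity)]
    ring
  -- Estimate sequence: `v` is the auxiliary point of Nesterov's scheme, and the potential `ψ(y) -
  -- ψ(u) + ν/2 ‖v - u‖²` contracts by `1 - θ` per step.
  suffices h : ∃ v : EuclideanSpace ℝ k,
      (1 + θ) • (fgm L ν ψ t).2 = (fgm L ν ψ t).1 + θ • v ∧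
      ψ (fgm L ν ψ t).1 - ψ u + ν / 2 * ‖v - u‖ ^ 2 ≤
        (1 - θ) ^ t * (ψ 0 - ψ u + ν / 2 * ‖u‖ ^ 2) by
    obtain ⟨v, -, h⟩ := h
    have : 0 ≤ ν / 2 * ‖v - u‖ ^ 2 := by positivity
    linarith
  induction t with
  | zero => exact ⟨0, by simp [fgm], by simp [fgm]⟩
  | succ t ih =>
    obtain ⟨v, hv, hE⟩ := ih
    set y := (fgm L ν ψ t).1
    set x := (fgm L ν ψ t).2
    set g := gradient ψ x
    have hy' : (fgm L ν ψ (t + 1)).1 = x - (1 / L) • g := rfl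
    have hx' : (fgm L ν ψ (t + 1)).2 =
        (x - (1 / L) • g) + ((√L - √ν) / (√L + √ν)) • ((x - (1 / L) • g) - y) := rfl
    have hyv : y = (1 + θ) • x - θ • v := by rw [hv]; abel
    -- The new `v` is a gradient step of length `θ / ν` from an average of `v` and `x`. Since `θ² L
    -- = ν`, its squared step costs the `‖g‖² / (2L)` that the descent step gains.
    refine ⟨(1 - θ) • v + θ • x - (θ / ν) • g, ?_, ?_⟩
    · rw [hx', hy', hβ, hyv]
      have h1 : θ * (θ / ν) = 1 / L := by
        rw [← hθν]
        field_simp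
      have h2 : (1 + θ) * ((1 - θ) / (1 + θ)) = 1 - θ := by field_simp
      rw [smul_add, smul_smul, h2, smul_sub θ, smul_smul θ (θ / ν), h1]
      module
    · rw [hy']
      have hd := hup x (x - (1 / L) • g)
      have hu := hlow x u
      have hyl := hlow x y
      have hyq : 0 ≤ ν / 2 * ‖y - x‖ ^ 2 := by positivity
      have hd' : ψ (x - (1 / L) • g) ≤ ψ x - 1 / (2 * L) * ‖g‖ ^ 2 := by
        rw [sub_sub_cancel_left, norm_neg, norm_smul, inner_neg_right, real_inner_smul_right,
          real_inner_self_eq_norm_sq, Real.norm_of_nonneg (by positivity)] at hd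
        refine hd.trans_eq ?_
        field_simp
        ring
      have hyx : y - x = θ • ((x - u) - (v - u)) := by
        rw [hyv]
        module
      have hux : u - x = -(x - u) := by abel
      have hvu : (1 - θ) • v + θ • x - (θ / ν) • g - u =
          ((1 - θ) • (v - u) + θ • (x - u)) - (θ / ν) • g := by module
      have hθL : ν / 2 * (θ / ν) ^ 2 = 1 / (2 * L) := by
        rw [← hθν]
        field_simp
      have hcv : ‖(1 - θ) • (v - u) + θ • (x - u)‖ ^ 2 ≤
          (1 - θ) * ‖v - u‖ ^ 2 + θ * ‖x - u‖ ^ 2 := by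
        have h := norm_sub_sq_real (v - u) (x - u)
        rw [norm_add_sq_real, norm_smul, norm_smul, real_inner_smul_left, real_inner_smul_right,
          Real.norm_of_nonneg hθ0.le, Real.norm_of_nonneg (sub_nonneg.mpr hθ1)]
        have h0 : 0 ≤ θ * (1 - θ) * ‖v - u - (x - u)‖ ^ 2 :=
          mul_nonneg (mul_nonneg hθ0.le (sub_nonneg.mpr hθ1)) (sq_nonneg _)
        rw [h] at h0
        linarith
      have hnorm : ν / 2 * ‖(1 - θ) • v + θ • x - (θ / ν) • g - u‖ ^ 2 ≤
          ν / 2 * ((1 - θ) * ‖v - u‖ ^ 2 + θ * ‖x - u‖ ^ 2) -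
          θ * ((1 - θ) * inner ℝ g (v - u) + θ * inner ℝ g (x - u)) + 1 / (2 * L) * ‖g‖ ^ 2 := by
        rw [hvu, norm_sub_sq_real, real_inner_smul_right, norm_smul,
          Real.norm_of_nonneg (by positivity), real_inner_comm, inner_add_right,
          real_inner_smul_right, real_inner_smul_right, mul_pow, ← hθL]
        have h1 : ν / 2 * (2 * (θ / ν * ((1 - θ) * inner ℝ g (v - u) + θ * inner ℝ g (x - u)))) =
            θ * ((1 - θ) * inner ℝ g (v - u) + θ * inner ℝ g (x - u)) := by field_simp
        have h2 := mul_le_mul_of_nonneg_left hcv (half_pos hν).le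
        linarith
      rw [hux, inner_neg_right, norm_neg] at hu
      rw [hyx, real_inner_smul_right, inner_sub_right, ← hyx] at hyl
      -- Weights `θ` at `u` and `1 - θ` at `y` make all inner products with `g` cancel, because `y -
      -- x = θ (x - v)`.
      have hu' := mul_le_mul_of_nonneg_left hu hθ0.le
      have hyl' := mul_le_mul_of_nonneg_left hyl (sub_nonneg.mpr hθ1)
      have hyq' := mul_nonneg (sub_nonneg.mpr hθ1) hyq
      have hE' := mul_le_mul_of_nonneg_left hE (sub_nonneg.mpr hθ1)
      rw [pow_succ' (1 - θ), mul_assoc]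
      refine le_trans ?_ hE'
      linarith

/-- The iterates of the fast gradient method approach the minimizer linearly. -/
lemma norm_fgm_sub_sq_le {ψ : EuclideanSpace ℝ k → ℝ} {L ν : ℝ} (hν : 0 < ν) (hL : ν ≤ L)
    (hlow : ∀ x y, ψ x + inner ℝ (gradient ψ x) (y - x) + ν / 2 * ‖y - x‖ ^ 2 ≤ ψ y)
    (hup : ∀ x y, ψ y ≤ ψ x + inner ℝ (gradient ψ x) (y - x) + L / 2 * ‖y - x‖ ^ 2)
    {u : EuclideanSpace ℝ k} (hu : gradient ψ u = 0) (t : ℕ) :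
    ‖(fgm L ν ψ t).1 - u‖ ^ 2 ≤ (1 - √(ν / L)) ^ t * ((L / ν + 1) * ‖u‖ ^ 2) := by
  have h1 := fgm_sub_add_le hν hL hlow hup u t
  have h2 := hlow u (fgm L ν ψ t).1
  -- Smoothness at the stationary point `u` bounds the initial gap by `L/2 ‖u‖²`, the source of `L /
  -- ν` in the constant.
  have h3 := hup u 0
  rw [hu, inner_zero_left] at h2 h3
  rw [zero_sub, norm_neg] at h3
  have hθ1 : √(ν / L) ≤ 1 :=
    (Real.sqrt_le_sqrt ((div_le_one (hν.trans_le hL)).mpr hL)).trans_eq Real.sqrt_one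
  have h4 : (1 - √(ν / L)) ^ t * (ψ 0 - ψ u + ν / 2 * ‖u‖ ^ 2) ≤
      (1 - √(ν / L)) ^ t * (ν / 2 * ((L / ν + 1) * ‖u‖ ^ 2)) := by
    refine mul_le_mul_of_nonneg_left ?_ (pow_nonneg (sub_nonneg.mpr hθ1) t)
    have : ν / 2 * ((L / ν + 1) * ‖u‖ ^ 2) = L / 2 * ‖u‖ ^ 2 + ν / 2 * ‖u‖ ^ 2 := by
      field_simp
    linarith
  refine le_of_mul_le_mul_left ?_ (half_pos hν)
  linarith

end FastGradient

/-! ### Iteration complexity -/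

/-- After `30 √κ log (2 + κ)` iterations the distance `d` to the regularized minimizer has dropped
below the slack `R - a` between the norms of the two dual solutions. -/
lemma mul_add_le_of_iterations {κ a b d R : ℝ} {N : ℕ} (hκ : 0 ≤ κ) (ha : 0 ≤ a)
    (hb : 0 ≤ b) (hd : 0 ≤ d) (hR : 0 ≤ R) (hab : a ^ 2 + b ^ 2 ≤ R ^ 2) (haκ : a ≤ κ * b)
    (hdN : d ^ 2 ≤ (1 - √(1 / (1 + κ))) ^ N * ((κ + 2) * a ^ 2))
    (hN : 30 * √κ * Real.log (2 + κ) ≤ N) : κ * d + a ≤ R ∧ d + a ≤ R := by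
  set θ := √(1 / (1 + κ)) with hθ
  have hθ0 : 0 ≤ θ := Real.sqrt_nonneg _
  have hθ1 : θ ≤ 1 :=
    (Real.sqrt_le_sqrt ((div_le_one (by linarith)).mpr (by linarith))).trans_eq Real.sqrt_one
  rcases le_total κ (1 / 4) with h | h
  -- For small `κ` the hypothesis may allow `N = 0`, so only the initial bound on `d` is used; here
  -- `a ≤ R/4` already leaves enough room.
  · have hbR : b ≤ R := by
      refine le_of_sq_le_sq ?_ hR
      nlinarith
    have haR : a ≤ 1 / 4 * R := haκ.trans (mul_le_mul h hbR hb (by norm_num))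
    have hda : d ≤ 3 / 2 * a := by
      refine le_of_sq_le_sq ?_ (by positivity)
      have h1 : (1 - θ) ^ N ≤ 1 := pow_le_one₀ (sub_nonneg.mpr hθ1) (by linarith)
      have h2 : (κ + 2) * a ^ 2 ≤ (9 / 4) * a ^ 2 := by
        gcongr
        linarith
      have h3 := mul_le_of_le_one_left (by positivity : 0 ≤ (κ + 2) * a ^ 2) h1
      nlinarith
    have : κ * d ≤ 1 / 4 * d := mul_le_mul_of_nonneg_right h hd
    constructor <;> linarith
  · set q := 2 + κ with hq
    have hq2 : 2 ≤ q := by linarith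
    have hlog : 0 ≤ Real.log q := Real.log_nonneg (by linarith)
    -- `θ √κ = √(κ / (1 + κ)) ≥ √(1/5) ≥ 2/5`, so the factor 30 yields the exponent `12 = 30 · 2/5`
    -- below.
    have hθκ : 2 / 5 ≤ θ * √κ := by
      rw [hθ, ← Real.sqrt_mul (by positivity)]
      refine Real.le_sqrt_of_sq_le ?_
      rw [one_div_mul_eq_div, le_div_iff₀ (by linarith)]
      linarith
    have hpow : (1 - θ) ^ N * q ^ 12 ≤ 1 := by
      have h1 : (1 - θ) ^ N ≤ Real.exp (-(θ * N)) := by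
        calc (1 - θ) ^ N ≤ Real.exp (-θ) ^ N := by
              exact pow_le_pow_left₀ (sub_nonneg.mpr hθ1) (Real.one_sub_le_exp_neg θ) N
          _ = Real.exp (-(θ * N)) := by
              rw [← Real.exp_nat_mul]
              congr 1
              ring
      have h2 : Real.exp (12 * Real.log q) = q ^ 12 := by
        rw [← Real.exp_log (by positivity : 0 < q ^ 12), Real.log_pow]
        norm_num
      have h3 : 12 * Real.log q ≤ θ * N := by
        have h4 := mul_le_mul_of_nonneg_left hN hθ0
        have h5 := mul_le_mul_of_nonneg_right hθκ hlog
        nlinarith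
      calc (1 - θ) ^ N * q ^ 12 ≤ Real.exp (-(θ * N)) * Real.exp (12 * Real.log q) := by
            rw [h2]
            gcongr
        _ = Real.exp (12 * Real.log q - θ * N) := by
            rw [← Real.exp_add]
            congr 1
            ring
        _ ≤ 1 := Real.exp_le_one_iff.mpr (by linarith)
    have hqd : q ^ 5 * d ≤ a := by
      refine le_of_sq_le_sq ?_ ha
      have h1 : d ^ 2 * q ^ 12 ≤ q * a ^ 2 := by
        calc d ^ 2 * q ^ 12 ≤ ((1 - θ) ^ N * ((κ + 2) * a ^ 2)) * q ^ 12 := by gcongr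
          _ = ((1 - θ) ^ N * q ^ 12) * (q * a ^ 2) := by
              rw [hq]
              ring
          _ ≤ 1 * (q * a ^ 2) := by gcongr
          _ = q * a ^ 2 := one_mul _
      have h2 : q * ((q ^ 5 * d) ^ 2 * q) ≤ q * (a ^ 2) := by linarith
      have h3 := le_of_mul_le_mul_left h2 (by linarith)
      have h4 : (q ^ 5 * d) ^ 2 * 1 ≤ (q ^ 5 * d) ^ 2 * q := by
        gcongr
        linarith
      linarith
    have he : q ^ 4 * (q * d) ≤ a := by linarith
    have he0 : 0 ≤ q * d := by positivity
    have hea : q * d ≤ a := by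
      refine le_trans ?_ he
      exact le_mul_of_one_le_left he0 (one_le_pow₀ (by linarith))
    have hsum : q * d + a ≤ R := by
      refine le_of_sq_le_sq ?_ hR
      -- Since `q d ≤ a`, the square `(q d + a)²` is at most `a² + 3 a q d`; it remains to fit `3 a
      -- q d` into `b²`, which follows from `q⁵ d ≤ a ≤ κ b`.
      have h1 : κ ^ 2 * (3 * (a * (q * d))) ≤ κ ^ 2 * b ^ 2 := by
        calc κ ^ 2 * (3 * (a * (q * d))) ≤ q ^ 2 * (q ^ 2 * (a * (q * d))) := by
              gcongr
              · linarith
              · nlinarith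
          _ = a * (q ^ 4 * (q * d)) := by ring
          _ ≤ a * a := by gcongr
          _ = a ^ 2 := by ring
          _ ≤ (κ * b) ^ 2 := by gcongr
          _ = κ ^ 2 * b ^ 2 := by ring
      have h2 := le_of_mul_le_mul_left h1 (by positivity)
      have h3 : (q * d) * (q * d) ≤ a * (q * d) := by gcongr
      nlinarith
    have h1 : κ * d ≤ q * d := by
      gcongr
      linarith
    have h2 : d ≤ q * d := le_mul_of_one_le_left hd (by linarith)
    constructor <;> linarith

lemma HasGradientAt.eq_zero_of_forall_le {E : Type*} [NormedAddCommGroup E]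
    [InnerProductSpace ℝ E] [CompleteSpace E] {ψ : E → ℝ} {x g : E} (hg : HasGradientAt ψ g x)
    (hx : ∀ y, ψ x ≤ ψ y) : g = 0 := by
  have hmin : IsLocalMin ψ x := Filter.Eventually.of_forall hx
  have h := hmin.hasFDerivAt_eq_zero hg.hasFDerivAt
  simpa using h

/-! ### Linearly constrained problems -/

section Constrained

variable {k : Type} [Fintype k]

lemma posSemidef_transpose_mul_self_real (A : Matrix k k ℝ) : (A.transpose * A).PosSemidef := by
  simpa using Matrix.posSemidef_conjTranspose_mul_self A

lemma sigmaMax_nonneg (A : Matrix k k ℝ) : 0 ≤ sigmaMax A :=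
  (posSemidef_transpose_mul_self_real A).lamMax_nonneg

lemma regularized_zero (ψ : EuclideanSpace ℝ k → ℝ) : regularized ψ 0 = ψ := by
  funext y
  simp [regularized]

lemma exists_forall_regularized_le {φ : EuclideanSpace ℝ k → ℝ} (hc : Continuous φ)
    {y₀ : EuclideanSpace ℝ k} (hy₀ : ∀ y, φ y₀ ≤ φ y) {ν : ℝ} (hν : 0 < ν) :
    ∃ u, ∀ y, regularized φ ν u ≤ regularized φ ν y := by
  refine Continuous.exists_forall_le (by unfold regularized; fun_prop) ?_
  have h : Filter.Tendsto (fun y : EuclideanSpace ℝ k => φ y₀ + ν / 2 * ‖y‖ ^ 2)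
      (Filter.cocompact _) Filter.atTop :=
    Filter.tendsto_atTop_add_const_left _ _
      (((Filter.tendsto_pow_atTop two_ne_zero).comp
        (tendsto_norm_cocompact_atTop)).const_mul_atTop (half_pos hν))
  exact Filter.tendsto_atTop_mono (fun y => by unfold regularized; linarith [hy₀ y]) h

variable [DecidableEq k] {F : EuclideanSpace ℝ k → ℝ}
  {X : EuclideanSpace ℝ k → EuclideanSpace ℝ k} {A : Matrix k k ℝ} {μ : ℝ}

lemma inner_toEuclideanLin_transpose_mul_self (A : Matrix k k ℝ) (y : EuclideanSpace ℝ k) :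
    inner ℝ y ((A.transpose * A).toEuclideanLin y) = ‖A.toEuclideanLin y‖ ^ 2 := by
  rw [EuclideanSpace.inner_eq_star_dotProduct, ← real_inner_self_eq_norm_sq,
    EuclideanSpace.inner_eq_star_dotProduct]
  simp only [Matrix.ofLp_toLpLin, Matrix.toLin'_apply, star_trivial]
  rw [← Matrix.mulVec_mulVec, dotProduct_comm, Matrix.dotProduct_mulVec, Matrix.vecMul_transpose]

lemma norm_toEuclideanLin_sq_le (A : Matrix k k ℝ) (d : EuclideanSpace ℝ k) :
    ‖A.toEuclideanLin d‖ ^ 2 ≤ sigmaMax A * ‖d‖ ^ 2 := by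
  rw [← inner_toEuclideanLin_transpose_mul_self]
  exact (posSemidef_transpose_mul_self_real A).isHermitian.inner_toEuclideanLin_self_le_lamMax d

/-- The oracle attains the supremum, so the family is bounded above and `⨆` does not take its
default value. -/
lemma dualFun_eq_dualValue (hA : A.transpose = A)
    (hX : ∀ z x, inner ℝ z x - F x ≤ inner ℝ z (X z) - F (X z)) :
    dualFun F A = dualValue F X A.toEuclideanLin := by
  funext y
  unfold dualFun dualValue
  rw [hA]
  exact le_antisymm (ciSup_le fun x => hX _ x)
    (le_ciSup (f := fun x => inner ℝ (A.toEuclideanLin y) x - F x)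
      ⟨_, by rintro _ ⟨x, rfl⟩; exact hX _ x⟩ (X (A.toEuclideanLin y)))

lemma isSymmetric_toEuclideanLin_of_transpose_eq (hA : A.transpose = A) :
    A.toEuclideanLin.IsSymmetric :=
  Matrix.isSymmetric_toEuclideanLin_iff.mpr (by
    rw [Matrix.IsHermitian, Matrix.conjTranspose_eq_transpose_of_trivial, hA])

/-- The regularized dual function is strongly convex. -/
lemma regularized_dualFun_add_inner_add_le (hA : A.transpose = A)
    (hX : ∀ z x, inner ℝ z x - F x ≤ inner ℝ z (X z) - F (X z)) (ν : ℝ)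
    (y w : EuclideanSpace ℝ k) :
    regularized (dualFun F A) ν y +
      inner ℝ (A.toEuclideanLin (X (A.toEuclideanLin y)) + ν • y) (w - y) +
      ν / 2 * ‖w - y‖ ^ 2 ≤ regularized (dualFun F A) ν w := by
  have h1 := dualValue_add_inner_le (isSymmetric_toEuclideanLin_of_transpose_eq hA) hX y w
  have h2 := add_inner_add_quadratic ν y w
  unfold regularized
  rw [dualFun_eq_dualValue hA hX, inner_add_left]
  linarith

/-- The regularized dual function is smooth. -/
lemma regularized_dualFun_le_add_inner_add (hμ : 0 < μ) (hF : StrongConvexOn Set.univ μ F)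
    (hA : A.transpose = A) (hX : ∀ z x, inner ℝ z x - F x ≤ inner ℝ z (X z) - F (X z)) (ν : ℝ)
    (y w : EuclideanSpace ℝ k) :
    regularized (dualFun F A) ν w ≤ regularized (dualFun F A) ν y +
      inner ℝ (A.toEuclideanLin (X (A.toEuclideanLin y)) + ν • y) (w - y) +
      (sigmaMax A / μ + ν) / 2 * ‖w - y‖ ^ 2 := by
  have h1 := dualValue_le_add_inner_add hμ hF (isSymmetric_toEuclideanLin_of_transpose_eq hA)
    (norm_toEuclideanLin_sq_le A) hX y w
  have h2 := add_inner_add_quadratic ν y w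
  unfold regularized
  rw [dualFun_eq_dualValue hA hX, inner_add_left]
  linarith

lemma hasGradientAt_regularized_dualFun (hμ : 0 < μ) (hF : StrongConvexOn Set.univ μ F)
    (hA : A.transpose = A) (hX : ∀ z x, inner ℝ z x - F x ≤ inner ℝ z (X z) - F (X z)) {ν : ℝ}
    (hν : 0 ≤ ν) (y : EuclideanSpace ℝ k) :
    HasGradientAt (regularized (dualFun F A) ν)
      (A.toEuclideanLin (X (A.toEuclideanLin y)) + ν • y) y :=
  hasGradientAt_of_quadratic_bounds
    (fun w => (le_add_of_nonneg_right (by positivity)).trans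
      (regularized_dualFun_add_inner_add_le hA hX ν y w))
    (fun w => regularized_dualFun_le_add_inner_add hμ hF hA hX ν y w)

lemma hasGradientAt_dualFun (hμ : 0 < μ) (hF : StrongConvexOn Set.univ μ F)
    (hA : A.transpose = A) (hX : ∀ z x, inner ℝ z x - F x ≤ inner ℝ z (X z) - F (X z))
    (y : EuclideanSpace ℝ k) :
    HasGradientAt (dualFun F A) (A.toEuclideanLin (X (A.toEuclideanLin y))) y := by
  have h := hasGradientAt_regularized_dualFun hμ hF hA hX le_rfl y
  rwa [regularized_zero, zero_smul, add_zero] at h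

/-- Weak duality. -/
lemma neg_le_dualFun (hA : A.transpose = A)
    (hX : ∀ z x, inner ℝ z x - F x ≤ inner ℝ z (X z) - F (X z)) {x : EuclideanSpace ℝ k}
    (hx : A.toEuclideanLin x = 0) (y : EuclideanSpace ℝ k) : -F x ≤ dualFun F A y := by
  have h := hX (A.toEuclideanLin y) x
  rw [isSymmetric_toEuclideanLin_of_transpose_eq hA y x, hx, inner_zero_right, zero_sub] at h
  rwa [dualFun_eq_dualValue hA hX]

/-- Strong duality, with a bound on a dual solution in terms of the Lipschitz constant. -/
lemma exists_dual_solution_norm_sq_le (hF : ConvexOn ℝ Set.univ F) (hA : A.transpose = A)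
    (hX : ∀ z x, inner ℝ z x - F x ≤ inner ℝ z (X z) - F (X z)) {xstar : EuclideanSpace ℝ k}
    (hx : IsPrimalSolution F A xstar) {M : NNReal}
    (hM : ∃ U ∈ 𝓝 xstar, LipschitzOnWith M F U) :
    ∃ y, (∀ y', dualFun F A y ≤ dualFun F A y') ∧ ‖y‖ ^ 2 ≤ (M : ℝ) ^ 2 / sigmaMin A := by
  have hT := isSymmetric_toEuclideanLin_of_transpose_eq hA
  obtain ⟨U, hU, hMU⟩ := hM
  obtain ⟨g, hg, hgS⟩ := hF.exists_subgradient_orthogonal (LinearMap.ker A.toEuclideanLin)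
    (a := xstar) hx.1 (fun x hx' => hx.2 x hx')
  have hgM := norm_subgradient_le hU hMU hg
  have hrange : g ∈ LinearMap.range A.toEuclideanLin := by
    rw [← Submodule.orthogonal_orthogonal (LinearMap.range A.toEuclideanLin), hT.orthogonal_range,
      Submodule.mem_orthogonal']
    exact hgS
  obtain ⟨y₀, hy₀⟩ := hrange
  set K := LinearMap.ker A.toEuclideanLin
  -- Dropping the kernel component keeps the image `g` and makes the bound by the smallest positive
  -- eigenvalue available.
  obtain ⟨p, hp, y, hy, hpy⟩ := K.exists_add_mem_mem_orthogonal y₀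
  have hyg : A.toEuclideanLin y = g := by
    rw [← hy₀, hpy, map_add, LinearMap.mem_ker.mp hp, zero_add]
  refine ⟨y, fun y' => ?_, ?_⟩
  -- Weak duality bounds `φ` below by `-F(x*)`, and the subgradient inequality at `X g` shows that
  -- `y` attains it.
  · refine le_trans ?_ (neg_le_dualFun hA hX hx.1 y')
    rw [dualFun_eq_dualValue hA hX]
    unfold dualValue
    rw [hyg]
    have h := hg (X g)
    rw [inner_sub_right, hgS xstar hx.1] at h
    linarith
  · have hB := posSemidef_transpose_mul_self_real A
    have hker (x : EuclideanSpace ℝ k) (h : (A.transpose * A).toEuclideanLin x = 0) :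
        inner ℝ x y = 0 := by
      refine (Submodule.mem_orthogonal K y).mp hy x (LinearMap.mem_ker.mpr ?_)
      rw [← norm_eq_zero, ← sq_eq_zero_iff, ← inner_toEuclideanLin_transpose_mul_self, h,
        inner_zero_right]
    have hbound := hB.lamMinPos_mul_le_inner hker
    rw [inner_toEuclideanLin_transpose_mul_self, hyg] at hbound
    -- Without positive eigenvalues `sigmaMin A` is the infimum of the empty set, `0`; then `y = 0`
    -- and the quotient by zero is `0`.
    by_cases hy0 : y = 0
    · rw [hy0, norm_zero]
      have : 0 ≤ sigmaMin A := lamMinPos_nonneg _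
      rw [zero_pow two_ne_zero]
      positivity
    · have hpos : 0 < sigmaMin A := hB.lamMinPos_pos_of_orthogonal_ker hker hy0
      rw [le_div_iff₀ hpos, mul_comm]
      exact hbound.trans (by gcongr)

/-- The minimizers form a nonempty closed set in finite dimension, so some minimizer is nearest to
`0`. -/
lemma exists_isMinNormDualSolution (hc : Continuous (dualFun F A))
    (h : ∃ y, ∀ y', dualFun F A y ≤ dualFun F A y') : ∃ y, IsMinNormDualSolution F A y := by
  have hcl : IsClosed {y | ∀ y', dualFun F A y ≤ dualFun F A y'} := by
    simp only [Set.ofPred_forall]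
    exact isClosed_iInter fun y' => isClosed_le hc continuous_const
  obtain ⟨y, hy, hd⟩ := hcl.exists_infDist_eq_dist h 0
  refine ⟨y, hy, fun y' hy' => ?_⟩
  have := Metric.infDist_le_dist_of_mem (x := 0) (s := {y | ∀ y', dualFun F A y ≤ dualFun F A y'})
    hy'
  rw [hd] at this
  simpa using this

/-- The fast gradient method on the regularized dual function yields an approximate primal
solution. -/
lemma isApproxSolution_fgm (hμ : 0 < μ) (hF : StrongConvexOn Set.univ μ F) (hA : A.transpose = A)
    (hX : ∀ z x, inner ℝ z x - F x ≤ inner ℝ z (X z) - F (X z)) {xstar : EuclideanSpace ℝ k}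
    (hx : IsPrimalSolution F A xstar) {ystar : EuclideanSpace ℝ k}
    (hy : ∀ y, dualFun F A ystar ≤ dualFun F A y) {ε R : ℝ} (hε : 0 < ε) (hR : R = ‖ystar‖)
    (hR0 : 0 < R) {L ν : ℝ} (hL : L = sigmaMax A / μ) (hν : ν = ε / R ^ 2) {N : ℕ}
    (hN : 30 * √(L / ν) * Real.log (2 + L / ν) ≤ N) :
    IsApproxSolution F A xstar ε (ε / R)
      (X (A.toEuclideanLin (fgm (L + ν) ν (regularized (dualFun F A) ν) N).1)) := by
  have hν0 : 0 < ν := by rw [hν]; positivity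
  have hL0 : 0 ≤ L := by rw [hL]; exact div_nonneg (sigmaMax_nonneg A) hμ.le
  set φ := dualFun F A with hφ
  set T := A.toEuclideanLin
  have hgrad (y : EuclideanSpace ℝ k) : gradient (regularized φ ν) y = T (X (T y)) + ν • y :=
    (hasGradientAt_regularized_dualFun hμ hF hA hX hν0.le y).gradient
  have hc : Continuous φ := continuous_iff_continuousAt.mpr fun y =>
    (hasGradientAt_dualFun hμ hF hA hX y).differentiableAt.continuousAt
  obtain ⟨u, hu⟩ := exists_forall_regularized_le hc hy hν0
  have hgu : T (X (T u)) + ν • u = 0 :=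
    (hasGradientAt_regularized_dualFun hμ hF hA hX hν0.le u).eq_zero_of_forall_le hu
  have hgy : T (X (T ystar)) = 0 :=
    (hasGradientAt_dualFun hμ hF hA hX ystar).eq_zero_of_forall_le hy
  have hlip := hF.norm_map_oracle_sub_le hμ (sigmaMax_nonneg A) (norm_toEuclideanLin_sq_le A) hX
  rw [← hL] at hlip
  have hTu : ‖T (X (T u))‖ = ν * ‖u‖ := by
    rw [eq_neg_of_add_eq_zero_left hgu, norm_neg, norm_smul, Real.norm_of_nonneg hν0.le]
  -- Strong convexity at `u` gives `ν/2 ‖y* - u‖²` of growth up to `y*`, while `φ(y*) ≤ φ(u)`; only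
  -- the regularizers remain.
  have hab : ‖u‖ ^ 2 + ‖ystar - u‖ ^ 2 ≤ R ^ 2 := by
    have h := regularized_dualFun_add_inner_add_le hA hX ν u ystar
    rw [hgu, inner_zero_left] at h
    unfold regularized at h
    rw [← hR] at h
    have h2 := hy u
    refine le_of_mul_le_mul_left ?_ (half_pos hν0)
    linarith
  have haκ : ‖u‖ ≤ L / ν * ‖ystar - u‖ := by
    have h := hlip u ystar
    rw [hgy, sub_zero, hTu, norm_sub_rev] at h
    rw [div_mul_eq_mul_div, le_div_iff₀ hν0]
    linarith
  set y := (fgm (L + ν) ν (regularized φ ν) N).1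
  have hdN : ‖y - u‖ ^ 2 ≤ (1 - √(1 / (1 + L / ν))) ^ N * ((L / ν + 2) * ‖u‖ ^ 2) := by
    have h := norm_fgm_sub_sq_le (ψ := regularized φ ν) (L := L + ν) hν0 (by linarith)
      (fun y w => by
        rw [hgrad]
        exact regularized_dualFun_add_inner_add_le hA hX ν y w)
      (fun y w => by
        rw [hgrad, hL]
        exact regularized_dualFun_le_add_inner_add hμ hF hA hX ν y w)
      (u := u) ((hgrad u).trans hgu) N
    have h1 : ν / (L + ν) = 1 / (1 + L / ν) := by field_simp; ring
    have h2 : (L + ν) / ν + 1 = L / ν + 2 := by field_simp; ring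
    rwa [h1, h2] at h
  obtain ⟨h1, h2⟩ := mul_add_le_of_iterations (div_nonneg hL0 hν0.le) (norm_nonneg u)
    (norm_nonneg _) (norm_nonneg _) hR0.le hab haκ hdN hN
  have hres : ‖T (X (T y))‖ ≤ ε / R := by
    calc ‖T (X (T y))‖ ≤ ‖T (X (T y)) - T (X (T u))‖ + ‖T (X (T u))‖ := by
          simpa using norm_add_le (T (X (T y)) - T (X (T u))) (T (X (T u)))
      _ ≤ L * ‖y - u‖ + ν * ‖u‖ := add_le_add (hlip y u) hTu.le
      _ = ν * (L / ν * ‖y - u‖ + ‖u‖) := by field_simp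
      _ ≤ ν * R := by gcongr
      _ = ε / R := by rw [hν]; field_simp
  refine ⟨?_, hres⟩
  have hyR : ‖y‖ ≤ R := by
    refine le_trans ?_ h2
    simpa using norm_add_le (y - u) u
  -- `-F(x*) ≤ φ(y) = ⟨y, ∇φ(y)⟩ - F(x)` at the oracle point `x = X (T y)`.
  have hweak := (neg_le_dualFun hA hX hx.1 ystar).trans (hy y)
  rw [hφ, dualFun_eq_dualValue hA hX] at hweak
  unfold dualValue at hweak
  rw [isSymmetric_toEuclideanLin_of_transpose_eq hA] at hweak
  have hin : inner ℝ y (T (X (T y))) ≤ ε := by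
    calc inner ℝ y (T (X (T y))) ≤ ‖y‖ * ‖T (X (T y))‖ := real_inner_le_norm _ _
      _ ≤ R * (ε / R) := by gcongr
      _ = ε := by field_simp
  linarith

end Constrained

/-! ### The network -/

section Network

variable {m n : ℕ}

lemma posSemidef_commMatrix (n : ℕ) (G : SimpleGraph (Fin m)) [DecidableRel G.Adj] :
    (commMatrix n G).PosSemidef :=
  (SimpleGraph.posSemidef_lapMatrix ℝ G).kronecker Matrix.PosSemidef.one

lemma sqrtComm_transpose (n : ℕ) (G : SimpleGraph (Fin m)) [DecidableRel G.Adj] :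
    (sqrtComm n G).transpose = sqrtComm n G := by
  rw [← Matrix.conjTranspose_eq_transpose_of_trivial]
  exact (Matrix.nonneg_iff_posSemidef.mp (CFC.sqrt_nonneg (commMatrix n G))).isHermitian

lemma sqrtComm_mul_self (n : ℕ) (G : SimpleGraph (Fin m)) [DecidableRel G.Adj] :
    sqrtComm n G * sqrtComm n G = commMatrix n G :=
  CFC.sqrt_mul_sqrt_self _ (posSemidef_commMatrix n G).nonneg

lemma toEuclideanLin_sqrtComm_sqrtComm (G : SimpleGraph (Fin m)) [DecidableRel G.Adj]
    (x : EuclideanSpace ℝ (Fin m × Fin n)) :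
    (sqrtComm n G).toEuclideanLin ((sqrtComm n G).toEuclideanLin x) =
      (commMatrix n G).toEuclideanLin x := by
  rw [← sqrtComm_mul_self]
  ext p
  simp [Matrix.toLpLin_apply, Matrix.mulVec_mulVec]

lemma toEuclideanLin_commMatrix_stack (G : SimpleGraph (Fin m)) [DecidableRel G.Adj]
    (u : Fin m → EuclideanSpace ℝ (Fin n)) :
    (commMatrix n G).toEuclideanLin (stack u) = stack fun i => ∑ j, G.lapMatrix ℝ i j • u j := by
  ext ⟨i, a⟩
  simp [Matrix.toLpLin_apply, stack, commMatrix, Matrix.mulVec, dotProduct,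
    Fintype.sum_prod_type, Matrix.one_apply]

lemma block_stack (u : Fin m → EuclideanSpace ℝ (Fin n)) (i : Fin m) : block (stack u) i = u i :=
  rfl

lemma inner_eq_sum_block (x y : EuclideanSpace ℝ (Fin m × Fin n)) :
    inner ℝ x y = ∑ i, inner ℝ (block x i) (block y i) := by
  simp [PiLp.inner_apply, Fintype.sum_prod_type, block]

lemma isDualOracle_totalCost {f : Fin m → EuclideanSpace ℝ (Fin n) → ℝ}
    {xs : Fin m → EuclideanSpace ℝ (Fin n) → EuclideanSpace ℝ (Fin n)}
    (hxs : ∀ i, IsDualOracle (f i) (xs i)) (z x : EuclideanSpace ℝ (Fin m × Fin n)) :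
    inner ℝ z x - totalCost f x ≤
      inner ℝ z (stack fun i => xs i (block z i)) -
        totalCost f (stack fun i => xs i (block z i)) := by
  simp only [inner_eq_sum_block, totalCost, block_stack, ← Finset.sum_sub_distrib]
  exact Finset.sum_le_sum fun i _ => hxs i _ _

/-- The distributed method is the fast gradient method in the variables `z = √W y`. -/
lemma stack_distributedFGM (G : SimpleGraph (Fin m)) [DecidableRel G.Adj]
    (xs : Fin m → EuclideanSpace ℝ (Fin n) → EuclideanSpace ℝ (Fin n)) {L ν : ℝ}
    {ψ : EuclideanSpace ℝ (Fin m × Fin n) → ℝ}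
    (hψ : ∀ y, gradient ψ y = (sqrtComm n G).toEuclideanLin
      (stack fun i => xs i (block ((sqrtComm n G).toEuclideanLin y) i)) + ν • y) (t : ℕ) :
    stack (distributedFGM G xs L ν t).1 =
        (sqrtComm n G).toEuclideanLin (fgm (L + ν) ν ψ t).1 ∧
      stack (distributedFGM G xs L ν t).2 =
        (sqrtComm n G).toEuclideanLin (fgm (L + ν) ν ψ t).2 := by
  induction t with
  | zero =>
    have h : stack (0 : Fin m → EuclideanSpace ℝ (Fin n)) = 0 := rfl
    simp [fgm, distributedFGM, h]
  | succ t ih =>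
    obtain ⟨h1, h2⟩ := ih
    have hz : stack (distributedFGM G xs L ν (t + 1)).1 =
        (sqrtComm n G).toEuclideanLin (fgm (L + ν) ν ψ (t + 1)).1 := by
      have hd : stack (distributedFGM G xs L ν (t + 1)).1 =
          stack (distributedFGM G xs L ν t).2 - (1 / (L + ν)) •
            ((stack fun i => ∑ j, G.lapMatrix ℝ i j • xs j ((distributedFGM G xs L ν t).2 j)) +
              ν • stack (distributedFGM G xs L ν t).2) := rfl
      have hf : (fgm (L + ν) ν ψ (t + 1)).1 = (fgm (L + ν) ν ψ t).2 -
          (1 / (L + ν)) • gradient ψ (fgm (L + ν) ν ψ t).2 := rfl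
      -- Applying `√W` to the gradient step turns the outer `√W` into `W`, which needs only
      -- neighbour communication.
      rw [hd, hf, hψ, ← h2, map_sub, map_smul, map_add, map_smul, toEuclideanLin_sqrtComm_sqrtComm,
        toEuclideanLin_commMatrix_stack, ← h2]
      rfl
    refine ⟨hz, ?_⟩
    have hd : stack (distributedFGM G xs L ν (t + 1)).2 =
        stack (distributedFGM G xs L ν (t + 1)).1 + ((√(L + ν) - √ν) / (√(L + ν) + √ν)) •
          (stack (distributedFGM G xs L ν (t + 1)).1 - stack (distributedFGM G xs L ν t).1) := rfl
    have hf : (fgm (L + ν) ν ψ (t + 1)).2 =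
        (fgm (L + ν) ν ψ (t + 1)).1 + ((√(L + ν) - √ν) / (√(L + ν) + √ν)) •
          ((fgm (L + ν) ν ψ (t + 1)).1 - (fgm (L + ν) ν ψ t).1) := rfl
    rw [hd, hf, hz, h1, map_add, map_smul, map_sub]

end Network

/-- Fast gradient method on the regularized dual of a distributed problem whose objective is
strongly convex and Lipschitz. The complexity bound `Õ(√K)`, `K = M² χ(W) / (μ ε)`, is stated as
`C √K log (2 + K)` with one absolute constant `C`. -/
theorem theorem2 :
    ∃ C : ℝ, 0 < C ∧
      ∀ (m n : ℕ) (G : SimpleGraph (Fin m)) [DecidableRel G.Adj], G.Connected →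
      ∀ (f : Fin m → EuclideanSpace ℝ (Fin n) → ℝ) (μ : ℝ) (M : NNReal),
        0 < μ → StrongConvexOn Set.univ μ (totalCost f) →
      ∀ xs : Fin m → EuclideanSpace ℝ (Fin n) → EuclideanSpace ℝ (Fin n),
        (∀ i, IsDualOracle (f i) (xs i)) →
      ∀ xstar : EuclideanSpace ℝ (Fin m × Fin n),
        IsPrimalSolution (totalCost f) (sqrtComm n G) xstar →
        (∃ U ∈ 𝓝 xstar, LipschitzOnWith M (totalCost f) U) →
      (∃ ystar, IsMinNormDualSolution (totalCost f) (sqrtComm n G) ystar) ∧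
      ∀ ystar, IsMinNormDualSolution (totalCost f) (sqrtComm n G) ystar →
        ‖ystar‖ ^ 2 ≤ (M : ℝ) ^ 2 / sigmaMin (sqrtComm n G) ∧
        ∀ ε : ℝ, 0 < ε → ∀ R : ℝ, R = ‖ystar‖ → 0 < R →
        ∀ Lφ : ℝ, Lφ = sigmaMax (sqrtComm n G) / μ →
        ∀ ν : ℝ, ν = ε / R ^ 2 →
          (∀ t : ℕ, stack (distributedFGM G xs Lφ ν t).1 =
            (sqrtComm n G).toEuclideanLin
              (fgm (Lφ + ν) ν (regularized (dualFun (totalCost f) (sqrtComm n G)) ν) t).1) ∧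
          ∀ N : ℕ,
            C * √((M : ℝ) ^ 2 / (μ * ε) * chi (commMatrix n G)) *
                Real.log (2 + (M : ℝ) ^ 2 / (μ * ε) * chi (commMatrix n G)) ≤ N →
            IsApproxSolution (totalCost f) (sqrtComm n G) xstar ε (ε / R)
              (stack fun i => xs i ((distributedFGM G xs Lφ ν N).1 i)) := by

  refine ⟨30, by norm_num, ?_⟩
  intro m n G _ _ f μ M hμ hF xs hxs xstar hx hM
  set A := sqrtComm n G
  have hA : A.transpose = A := sqrtComm_transpose n G
  have hW : A.transpose * A = commMatrix n G := by rw [hA, sqrtComm_mul_self]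
  have hX := isDualOracle_totalCost hxs
  have hμ2 : (0 : ℝ → ℝ) ≤ fun r => μ / 2 * r ^ 2 := fun r => by
    simp only [Pi.zero_apply]
    positivity
  obtain ⟨y₀, hy₀, hy₀M⟩ := exists_dual_solution_norm_sq_le (hF.convexOn hμ2) hA hX hx hM
  have hc : Continuous (dualFun (totalCost f) A) := continuous_iff_continuousAt.mpr fun y =>
    (hasGradientAt_dualFun hμ hF hA hX y).differentiableAt.continuousAt
  refine ⟨exists_isMinNormDualSolution hc ⟨y₀, hy₀⟩, fun ystar hy => ?_⟩
  have hyM : ‖ystar‖ ^ 2 ≤ (M : ℝ) ^ 2 / sigmaMin A :=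
    (pow_le_pow_left₀ (norm_nonneg _) (hy.2 y₀ hy₀) 2).trans hy₀M
  refine ⟨hyM, fun ε hε R hR hR0 L hL ν hν => ?_⟩
  have hν0 : 0 < ν := by rw [hν]; positivity
  have hiter := stack_distributedFGM G xs (L := L) fun y =>
    (hasGradientAt_regularized_dualFun hμ hF hA hX hν0.le y).gradient
  refine ⟨fun t => (hiter t).1, fun N hN => ?_⟩
  have hblock (i : Fin m) : (distributedFGM G xs L ν N).1 i =
      block (A.toEuclideanLin
        (fgm (L + ν) ν (regularized (dualFun (totalCost f) A) ν) N).1) i := by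
    rw [← (hiter N).1, block_stack]
  simp only [hblock]
  refine isApproxSolution_fgm hμ hF hA hX hx hy.1 hε hR hR0 hL hν (le_trans ?_ hN)
  have hL0 : 0 ≤ L := by rw [hL]; exact div_nonneg (sigmaMax_nonneg A) hμ.le
  -- The bound on the dual norm enters here: `κ = L R² / ε` is at most `K`, and the iteration
  -- threshold is increasing in `κ`.
  have hκ : L / ν ≤ (M : ℝ) ^ 2 / (μ * ε) * chi (commMatrix n G) := by
    calc L / ν = sigmaMax A / (μ * ε) * ‖ystar‖ ^ 2 := by
          rw [hL, hν, hR]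
          field_simp
      _ ≤ sigmaMax A / (μ * ε) * ((M : ℝ) ^ 2 / sigmaMin A) := by
          have := sigmaMax_nonneg A
          gcongr
      _ = (M : ℝ) ^ 2 / (μ * ε) * chi (commMatrix n G) := by
          rw [chi, ← hW, sigmaMax, sigmaMin]
          ring
  have hκ0 : 0 ≤ L / ν := div_nonneg hL0 hν0.le
  have hlog : 0 ≤ Real.log (2 + L / ν) := Real.log_nonneg (by linarith)
  gcongr
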